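/- Let $\Lambda\subset\mathbb{R}^2$ be a planar lattice (a discrete subgroup of the Euclidean plane spanning it over $\mathbb{R}$). A coincidence reflection of $\Lambda$ is an orthogonal reflection $R$ in a line through the origin such that $\Lambda\cap R\Lambda$ has full rank, and its coincidence index is the group index $[\Lambda:\Lambda\cap R\Lambda]$. A lattice is well-rounded if its nonzero vectors of minimal length span $\mathbb{R}^2$. Suppose that $\Lambda$ has exactly two coincidence reflections. Then both have the same coincidence index $\Sigma\in\mathbb{N}$, $\Sigma \geq 1$; for every $n\geq 1$ the number $a_\Lambda(n)$ of well-rounded sublattices of $\Lambda$ of index $n$ is finite; and the summatory function $A_\Lambda(x)=\sum_{n\le x}a_\Lambda(n)$ satisfies $$A_\Lambda(x)=\frac{\log 3}{4\Sigma}\,x+O(\sqrt{x})\qquad (x\to\infty),$$ where the implied constant may depend on $\Lambda$. In particular, the leading term depends only on $\Sigma$. -/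

import Mathlib

open Asymptotics Filter

/-- The vectors of minimal nonzero length of a lattice. -/
def minimalVectors {E : Type*} [NormedAddCommGroup E] (M : Submodule ℤ E) : Set E :=
  {v | v ∈ M ∧ v ≠ 0 ∧ ∀ w ∈ M, w ≠ 0 → ‖v‖ ≤ ‖w‖}

/-- A lattice is well-rounded if its vectors of minimal nonzero length span the ambient space. -/
def IsWellRounded {E : Type*} [NormedAddCommGroup E] [NormedSpace ℝ E]
    (M : Submodule ℤ E) : Prop :=
  Submodule.span ℝ (minimalVectors M) = ⊤

/-- The index of `M` in `L` as additive groups (`0` encodes infinite index); used for `M ≤ L`. -/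
noncomputable def latticeIndex {E : Type*} [AddCommGroup E] (L M : Submodule ℤ E) : ℕ :=
  M.toAddSubgroup.relIndex L.toAddSubgroup

/-- The intersection `L ∩ R L`, for a linear isometry `R`. -/
def cslOf {E : Type*} [NormedAddCommGroup E] [NormedSpace ℝ E]
    (L : Submodule ℤ E) (R : E ≃ₗᵢ[ℝ] E) : Submodule ℤ E :=
  L ⊓ L.map (R.toLinearEquiv.toLinearMap.restrictScalars ℤ)

/-- `R` is a coincidence isometry of `L` if `L ∩ R L` has full rank. -/
def IsCoincidenceIsometry {E : Type*} [NormedAddCommGroup E] [NormedSpace ℝ E]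
    (L : Submodule ℤ E) (R : E ≃ₗᵢ[ℝ] E) : Prop :=
  Submodule.span ℝ (cslOf L R : Set E) = ⊤

/-- The coincidence index: the index of `L ∩ R L` in `L`. -/
noncomputable def coincidenceIndex {E : Type*} [NormedAddCommGroup E] [NormedSpace ℝ E]
    (L : Submodule ℤ E) (R : E ≃ₗᵢ[ℝ] E) : ℕ :=
  latticeIndex L (cslOf L R)

/-- A coincidence reflection of `L`: a coincidence isometry that is the orthogonal reflection
in the hyperplane (in the plane: the line) perpendicular to a nonzero vector. -/
def IsCoincidenceReflection {E : Type*} [NormedAddCommGroup E] [InnerProductSpace ℝ E]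
    (L : Submodule ℤ E) (R : E ≃ₗᵢ[ℝ] E) : Prop :=
  (∃ v : E, v ≠ 0 ∧ R = (Submodule.span ℝ {v})ᗮ.reflection) ∧ IsCoincidenceIsometry L R

/-- The well-rounded sublattices of `L` of index `n`. -/
def wellRoundedSublattices {E : Type*} [NormedAddCommGroup E] [NormedSpace ℝ E]
    (L : Submodule ℤ E) (n : ℕ) : Set (Submodule ℤ E) :=
  {M | M ≤ L ∧ latticeIndex L M = n ∧ IsWellRounded M}

/-- The summatory function of `n ↦ #{well-rounded sublattices of index n}`, `1 ≤ n ≤ x`. -/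
noncomputable def wellRoundedCount {E : Type*} [NormedAddCommGroup E] [NormedSpace ℝ E]
    (L : Submodule ℤ E) (x : ℝ) : ℕ :=
  ∑ n ∈ Finset.Icc 1 ⌊x⌋₊, (wellRoundedSublattices L n).ncard

/-!
A well-rounded planar lattice `M` is generated by two independent minimal vectors `a` and `b`, and
the reflection in `(a - b)ᗮ` exchanges them. If `M ≤ L`, this is a coincidence reflection of `L`.
When `L` has just two of these, their axes `ℝ e` and `ℝ f` are orthogonal, both reflections have
the same lattice `L ∩ R L`, and `e`, `f` can be scaled so that it consists of the `p • e + q • f`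
with `q ≡ p` modulo `d`, where `d` is `1` or `2`. Hence `M` is the rhombic lattice whose half
diagonals are `p • e` and `q • f` for such `p, q > 0`, and it is well-rounded exactly when neither
diagonal is longer than `√3` times the other. This restricts the slope `q / p` to an interval whose
end points have quotient `3`. The index of `M` in `L` is `2 p q Σ / d`, so one counts the pairs with
`p q ≤ y = d x / (2 Σ)` in a sector; up to `O(√y)` this is its area `y (log 3) / 2` divided
by `d`, and `d` cancels.
-/

lemma ncard_biUnion_finset {α ι : Type*} {t : Finset ι} {s : ι → Set α}
    (hfin : ∀ i ∈ t, (s i).Finite) (hdisj : (t : Set ι).PairwiseDisjoint s) :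
    (⋃ i ∈ t, s i).ncard = ∑ i ∈ t, (s i).ncard := by
  rw [← finsum_mem_coe_finset]
  exact t.finite_toSet.ncard_biUnion hfin hdisj

lemma abs_card_Icc_ceil_floor_sub_le {a b : ℝ} (hab : a ≤ b) :
    |((Finset.Icc ⌈a⌉ ⌊b⌋).card : ℝ) - (b - a)| ≤ 1 := by
  have ha := Int.ceil_lt_add_one a
  have hb := Int.lt_floor_add_one b
  have hnonneg : 0 ≤ ⌊b⌋ + 1 - ⌈a⌉ := by
    have : ((-1 : ℤ) : ℝ) < ((⌊b⌋ + 1 - ⌈a⌉ : ℤ) : ℝ) := by push_cast; linarith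
    exact Int.lt_iff_add_one_le.1 (Int.cast_lt.1 this)
  have hcard : ((Finset.Icc ⌈a⌉ ⌊b⌋).card : ℝ) = ⌊b⌋ + 1 - ⌈a⌉ := by
    rw [Int.card_Icc]
    exact_mod_cast Int.toNat_of_nonneg hnonneg
  rw [hcard, abs_le]
  constructor <;> linarith [Int.le_ceil a, Int.floor_le b]

lemma setOf_modEq_Icc_eq_image {d : ℕ} (hd : 0 < d) (v : ℤ) (a b : ℝ) :
    {q : ℤ | q ≡ v [ZMOD d] ∧ (q : ℝ) ∈ Set.Icc a b} =
      (fun k : ℤ ↦ v + d * k) '' Finset.Icc ⌈(a - v) / d⌉ ⌊(b - v) / d⌋ := by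
  have hd' : (0 : ℝ) < d := Nat.cast_pos.2 hd
  have hmem (k : ℤ) : k ∈ Finset.Icc ⌈(a - v) / d⌉ ⌊(b - v) / d⌋ ↔
      ((v + d * k : ℤ) : ℝ) ∈ Set.Icc a b := by
    rw [Finset.mem_Icc, Int.ceil_le, Int.le_floor, div_le_iff₀ hd', le_div_iff₀ hd', Set.mem_Icc]
    push_cast
    constructor <;> rintro ⟨h₁, h₂⟩ <;> constructor <;> linarith
  ext q
  constructor
  · rintro ⟨hmod, hIcc⟩
    obtain ⟨k, rfl⟩ := Int.modEq_iff_add_fac.1 hmod.symm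
    exact ⟨k, Finset.mem_coe.2 ((hmem k).2 hIcc), rfl⟩
  · rintro ⟨k, hk, rfl⟩
    exact ⟨(Int.modEq_iff_add_fac.2 ⟨k, rfl⟩).symm, (hmem k).1 (Finset.mem_coe.1 hk)⟩

lemma finite_setOf_modEq_Icc {d : ℕ} (hd : 0 < d) (v : ℤ) (a b : ℝ) :
    {q : ℤ | q ≡ v [ZMOD d] ∧ (q : ℝ) ∈ Set.Icc a b}.Finite := by
  rw [setOf_modEq_Icc_eq_image hd]
  exact (Finset.finite_toSet _).image _

lemma abs_ncard_modEq_Icc_sub_le {d : ℕ} (hd : 0 < d) (v : ℤ) {a b : ℝ} (hab : a ≤ b) :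
    |({q : ℤ | q ≡ v [ZMOD d] ∧ (q : ℝ) ∈ Set.Icc a b}.ncard : ℝ) - (b - a) / d| ≤ 1 := by
  have hinj : Function.Injective fun k : ℤ ↦ v + d * k := fun k l hkl ↦
    mul_left_cancel₀ (Nat.cast_ne_zero.2 hd.ne') (add_left_cancel hkl)
  rw [setOf_modEq_Icc_eq_image hd, Set.ncard_image_of_injective _ hinj, Set.ncard_coe_finset,
    show (b - a) / d = (b - v) / d - (a - v) / d by ring]
  exact abs_card_Icc_ceil_floor_sub_le (by gcongr)

lemma abs_sum_Ioc_floor_sub_le {t : ℝ} (ht : 0 ≤ t) :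
    |∑ p ∈ Finset.Ioc 0 ⌊t⌋₊, (p : ℝ) - t ^ 2 / 2| ≤ t := by
  have sum_eq (n : ℕ) : ∑ p ∈ Finset.Ioc 0 n, (p : ℝ) = n * (n + 1) / 2 := by
    induction n with
    | zero => simp
    | succ n ih => rw [Finset.sum_Ioc_succ_top n.zero_le, ih]; push_cast; ring
  have hle := Nat.floor_le ht
  have hlt := Nat.lt_floor_add_one t
  rw [sum_eq, abs_le]
  constructor <;> nlinarith [(Nat.cast_nonneg ⌊t⌋₊ : (0 : ℝ) ≤ _)]

lemma abs_harmonic_floor_sub_log_le {t : ℝ} (ht : 1 ≤ t) :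
    |(harmonic ⌊t⌋₊ : ℝ) - Real.log t - Real.eulerMascheroniConstant| ≤ 2 / t := by
  have hn : 1 ≤ ⌊t⌋₊ := Nat.le_floor (by simpa using ht)
  have hle := Nat.floor_le (zero_le_one.trans ht)
  have hlt := Nat.lt_floor_add_one t
  have hlower := Real.eulerMascheroniSeq_lt_eulerMascheroniConstant ⌊t⌋₊
  have hupper := Real.eulerMascheroniConstant_lt_eulerMascheroniSeq' ⌊t⌋₊
  rw [Real.eulerMascheroniSeq] at hlower
  rw [Real.eulerMascheroniSeq', if_neg (by omega)] at hupper
  set n := ⌊t⌋₊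
  have hn' : (1 : ℝ) ≤ n := Nat.one_le_cast.2 hn
  have hlog_le : Real.log n ≤ Real.log t := Real.log_le_log (by linarith) hle
  have hlog_le' : Real.log t ≤ Real.log (n + 1) := Real.log_le_log (by linarith) hlt.le
  have hlog_sub : Real.log (n + 1) - Real.log n ≤ 2 / t :=
    calc Real.log (n + 1) - Real.log n = Real.log ((n + 1) / n) :=
          (Real.log_div (by linarith) (by linarith)).symm
      _ ≤ (n + 1) / n - 1 := Real.log_le_sub_one_of_pos (by positivity)
      _ = 1 / n := by field_simp; ring
      _ ≤ 2 / t := by rw [div_le_div_iff₀ (by linarith) (by linarith)]; linarith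
  rw [abs_le]
  constructor <;> linarith

lemma abs_sum_Ioc_floor_inv_sub_log_le {a b : ℝ} (ha : 1 ≤ a) (hab : a ≤ b) :
    |∑ p ∈ Finset.Ioc ⌊a⌋₊ ⌊b⌋₊, (p : ℝ)⁻¹ - Real.log (b / a)| ≤ 2 / a + 2 / b := by
  have hsum : ∑ p ∈ Finset.Ioc ⌊a⌋₊ ⌊b⌋₊, (p : ℝ)⁻¹ = (harmonic ⌊b⌋₊ : ℝ) - harmonic ⌊a⌋₊ := by
    rw [harmonic_eq_sum_Icc, harmonic_eq_sum_Icc]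
    have := Finset.sum_Ioc_consecutive (fun p : ℕ ↦ (p : ℝ)⁻¹) ⌊a⌋₊.zero_le
      (Nat.floor_le_floor hab)
    push_cast
    exact eq_sub_of_add_eq' this
  have ha' := abs_harmonic_floor_sub_log_le ha
  have hb' := abs_harmonic_floor_sub_log_le (ha.trans hab)
  rw [hsum, Real.log_div (by linarith) (by linarith)]
  rw [abs_le] at *
  constructor <;> linarith

lemma sum_Ioc_floor_min_mul_div {s a b : ℝ} (hs : 0 ≤ s) (ha : 0 < a) (hab : a ≤ b) :
    ∑ p ∈ Finset.Ioc 0 ⌊b⌋₊, min (s * p) (s * a ^ 2 / p) =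
      s * ∑ p ∈ Finset.Ioc 0 ⌊a⌋₊, (p : ℝ) +
        s * a ^ 2 * ∑ p ∈ Finset.Ioc ⌊a⌋₊ ⌊b⌋₊, (p : ℝ)⁻¹ := by
  rw [← Finset.sum_Ioc_consecutive _ ⌊a⌋₊.zero_le (Nat.floor_le_floor hab), Finset.mul_sum,
    Finset.mul_sum]
  congr 1 <;> refine Finset.sum_congr rfl fun p hp ↦ ?_ <;>
    obtain ⟨hlt, hle⟩ := Finset.mem_Ioc.1 hp
  · have : (0 : ℝ) < p := Nat.cast_pos.2 hlt
    have hpa : (p : ℝ) ≤ a := (Nat.le_floor_iff ha.le).1 hle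
    refine min_eq_left ?_
    calc s * p = s * p ^ 2 / p := by field_simp
      _ ≤ s * a ^ 2 / p := by gcongr
  · have hap : a < p := (Nat.floor_lt ha.le).1 hlt
    have : (0 : ℝ) < p := ha.trans hap
    refine (min_eq_right ?_).trans (div_eq_mul_inv _ _)
    calc s * a ^ 2 / p ≤ s * p ^ 2 / p := by gcongr
      _ = s * p := by field_simp

lemma abs_sum_min_sub_mul_log_le {r s a b : ℝ} (hr : 0 < r) (hs : 0 < s) (ha : 1 ≤ a)
    (hab : a ≤ b) (heq : s * a ^ 2 = r * b ^ 2) :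
    |∑ p ∈ Finset.Ioc 0 ⌊b⌋₊, (min (s * p) (s * a ^ 2 / p) - r * p) -
      s * a ^ 2 * Real.log (b / a)| ≤ 3 * (s * a + r * b) := by
  have hinner := abs_sum_Ioc_floor_sub_le (zero_le_one.trans ha)
  have houter := abs_sum_Ioc_floor_inv_sub_log_le ha hab
  have hlower := abs_sum_Ioc_floor_sub_le (zero_le_one.trans (ha.trans hab))
  rw [Finset.sum_sub_distrib, sum_Ioc_floor_min_mul_div hs.le (by linarith) hab, ← Finset.mul_sum]
  generalize ∑ p ∈ Finset.Ioc 0 ⌊a⌋₊, (p : ℝ) = S at *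
  generalize ∑ p ∈ Finset.Ioc ⌊a⌋₊ ⌊b⌋₊, (p : ℝ)⁻¹ = T at *
  generalize ∑ p ∈ Finset.Ioc 0 ⌊b⌋₊, (p : ℝ) = U at *
  have hsplit : s * S + s * a ^ 2 * T - r * U - s * a ^ 2 * Real.log (b / a) =
      s * (S - a ^ 2 / 2) + s * a ^ 2 * (T - Real.log (b / a)) - r * (U - b ^ 2 / 2) := by
    linear_combination heq / 2
  have herror : s * a ^ 2 * (2 / a + 2 / b) = 2 * (s * a) + 2 * (r * b) := by
    have : b ≠ 0 := by linarith
    calc s * a ^ 2 * (2 / a + 2 / b) = s * a ^ 2 * (2 / a) + r * b ^ 2 * (2 / b) := by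
          rw [mul_add, heq]
      _ = 2 * (s * a) + 2 * (r * b) := by field_simp
  calc _ ≤ |s * (S - a ^ 2 / 2)| + |s * a ^ 2 * (T - Real.log (b / a))| +
          |r * (U - b ^ 2 / 2)| := by
        rw [hsplit]
        exact (abs_sub _ _).trans (add_le_add_left (abs_add_le _ _) _)
    _ ≤ s * a + s * a ^ 2 * (2 / a + 2 / b) + r * b := by
        rw [abs_mul, abs_mul (s * a ^ 2), abs_mul r, abs_of_pos hs, abs_of_pos hr,
          abs_of_nonneg (by positivity : 0 ≤ s * a ^ 2)]
        gcongr
    _ = _ := by rw [herror]; ring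

lemma mul_sqrt_div {t : ℝ} (ht : 0 < t) (y : ℝ) : t * √(y / t) = √t * √y := by
  nth_rewrite 1 [← Real.mul_self_sqrt ht.le]
  rw [Real.sqrt_div' _ ht.le]
  field_simp

lemma abs_sum_min_mul_div_sub_le {r s y : ℝ} (hr : 0 < r) (hrs : r ≤ s) (hy : s ≤ y) :
    |∑ p ∈ Finset.Ioc 0 ⌊√(y / r)⌋₊, (min (s * p) (y / p) - r * p) - y / 2 * Real.log (s / r)|
      ≤ 3 * (√s + √r) * √y := by
  have hs : 0 < s := hr.trans_le hrs
  have hy0 : 0 < y := hs.trans_le hy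
  have mul_sq {t : ℝ} (ht : 0 < t) : t * √(y / t) ^ 2 = y := by
    rw [Real.sq_sqrt (by positivity), mul_div_cancel₀ _ ht.ne']
  have hlog : Real.log (√(y / r) / √(y / s)) = Real.log (s / r) / 2 := by
    rw [← Real.sqrt_div (by positivity), Real.log_sqrt (by positivity)]
    congr 2
    field_simp
  have hbound := abs_sum_min_sub_mul_log_le hr hs (Real.one_le_sqrt.2 ((one_le_div hs).2 hy))
    (Real.sqrt_le_sqrt (by gcongr)) ((mul_sq hs).trans (mul_sq hr).symm)
  rwa [mul_sq hs, hlog, mul_sqrt_div hs, mul_sqrt_div hr, ← add_mul, mul_div_assoc', mul_comm y,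
    ← mul_div_assoc', mul_comm (Real.log _), ← mul_assoc] at hbound

/-- The integer points `(p, q)` in the open positive quadrant with `q ≡ p` modulo `d`, in the
sector of slopes `q / p` between `r` and `s`. They will parametrise well-rounded lattices, in such
a way that the index is proportional to `p * q`. -/
def sectorPoints (d : ℕ) (r s : ℝ) : Set (ℤ × ℤ) :=
  {z | 0 < z.1 ∧ 0 < z.2 ∧ z.2 ≡ z.1 [ZMOD d] ∧ r * z.1 ≤ z.2 ∧ z.2 ≤ s * z.1}

lemma sectorPoints_inter_mul_le_eq_biUnion (d : ℕ) {r s : ℝ} (hr : 0 < r) (y : ℝ) :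
    sectorPoints d r s ∩ {z | (z.1 * z.2 : ℝ) ≤ y} = ⋃ p ∈ Finset.Ioc 0 ⌊√(y / r)⌋₊,
      (fun q : ℤ ↦ ((p : ℤ), q)) ''
        {q : ℤ | q ≡ p [ZMOD d] ∧ (q : ℝ) ∈ Set.Icc (r * p) (min (s * p) (y / p))} := by
  ext ⟨p, q⟩
  simp only [sectorPoints, Set.mem_inter_iff, Set.mem_ofPred_eq, Set.mem_iUnion, Set.mem_image,
    Finset.mem_Ioc, exists_prop, Set.mem_Icc, le_min_iff, Prod.mk.injEq]
  constructor
  · rintro ⟨⟨hp, -, hmod, hrp, hsp⟩, hpq⟩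
    lift p to ℕ using hp.le
    have hp0 : (0 : ℝ) < p := Nat.cast_pos.2 (Int.natCast_pos.1 hp)
    push_cast at hrp hsp hpq
    refine ⟨p, ⟨Int.natCast_pos.1 hp, Nat.le_floor (Real.le_sqrt_of_sq_le ?_)⟩, q,
      ⟨hmod, hrp, hsp, (le_div_iff₀' hp0).2 hpq⟩, rfl, rfl⟩
    rw [le_div_iff₀ hr]
    nlinarith
  · rintro ⟨p, ⟨hp, -⟩, q, ⟨hmod, hrp, hsp, hqy⟩, rfl, rfl⟩
    have hp0 : (0 : ℝ) < p := Nat.cast_pos.2 hp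
    have hq0 : (0 : ℝ) < q := (mul_pos hr hp0).trans_le hrp
    exact ⟨⟨Int.natCast_pos.2 hp, Int.cast_pos.1 hq0, hmod, hrp, hsp⟩, (le_div_iff₀' hp0).1 hqy⟩

lemma finite_sectorPoints_inter_mul_le {d : ℕ} (hd : 0 < d) {r : ℝ} (hr : 0 < r) (s y : ℝ) :
    (sectorPoints d r s ∩ {z | (z.1 * z.2 : ℝ) ≤ y}).Finite := by
  rw [sectorPoints_inter_mul_le_eq_biUnion d hr]
  exact Set.Finite.biUnion (Finset.finite_toSet _)
    fun p _ ↦ (finite_setOf_modEq_Icc hd p _ _).image _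

lemma ncard_sectorPoints_inter_mul_le {d : ℕ} (hd : 0 < d) {r : ℝ} (hr : 0 < r) (s y : ℝ) :
    (sectorPoints d r s ∩ {z | (z.1 * z.2 : ℝ) ≤ y}).ncard = ∑ p ∈ Finset.Ioc 0 ⌊√(y / r)⌋₊,
      {q : ℤ | q ≡ p [ZMOD d] ∧ (q : ℝ) ∈ Set.Icc (r * p) (min (s * p) (y / p))}.ncard := by
  rw [sectorPoints_inter_mul_le_eq_biUnion d hr]
  refine (ncard_biUnion_finset
    (fun (p : ℕ) _ ↦ (finite_setOf_modEq_Icc hd (p : ℤ) _ _).image _) ?_).trans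
    (Finset.sum_congr rfl fun _ _ ↦
      Set.ncard_image_of_injective _ fun _ _ h ↦ (Prod.mk.inj h).2)
  refine fun p _ p' _ hne ↦ Set.disjoint_left.2 ?_
  rintro _ ⟨q, -, rfl⟩ ⟨q', -, h⟩
  exact hne (Int.natCast_inj.1 (Prod.mk.inj h).1.symm)

lemma abs_ncard_sectorPoints_inter_sub_le {d : ℕ} (hd : 0 < d) {r s y : ℝ} (hr : 0 < r)
    (hrs : r ≤ s) (hy : s ≤ y) :
    |((sectorPoints d r s ∩ {z | (z.1 * z.2 : ℝ) ≤ y}).ncard : ℝ) -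
      Real.log (s / r) / (2 * d) * y| ≤ (1 / √r + 3 * (√s + √r)) * √y := by
  have hd1 : (1 : ℝ) ≤ d := Nat.one_le_cast.2 hd
  have hy0 : 0 < y := hr.trans_le (hrs.trans hy)
  rw [ncard_sectorPoints_inter_mul_le hd hr, Nat.cast_sum]
  have hslices : |∑ p ∈ Finset.Ioc 0 ⌊√(y / r)⌋₊,
      (({q : ℤ | q ≡ p [ZMOD d] ∧ (q : ℝ) ∈ Set.Icc (r * p) (min (s * p) (y / p))}.ncard : ℝ) -
        (min (s * p) (y / p) - r * p) / d)| ≤ 1 / √r * √y := by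
    refine (Finset.abs_sum_le_sum_abs _ _).trans ((Finset.sum_le_card_nsmul _ _ 1 ?_).trans ?_)
    · intro p hp
      obtain ⟨hp0, hpB⟩ := Finset.mem_Ioc.1 hp
      have hp0' : (0 : ℝ) < p := Nat.cast_pos.2 hp0
      refine abs_ncard_modEq_Icc_sub_le hd p (le_min (by gcongr) ?_)
      have hp_sq : (p : ℝ) ^ 2 ≤ y / r :=
        (Real.le_sqrt' hp0').1 ((Nat.le_floor_iff (by positivity)).1 hpB)
      rw [le_div_iff₀ hr] at hp_sq
      rw [le_div_iff₀ hp0']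
      linarith
    · rw [Nat.card_Ioc, Nat.sub_zero, nsmul_one, one_div_mul_eq_div, ← Real.sqrt_div hy0.le]
      exact Nat.floor_le (Real.sqrt_nonneg _)
  have hmain := abs_sum_min_mul_div_sub_le hr hrs hy
  rw [Finset.sum_sub_distrib, ← Finset.sum_div] at hslices
  generalize ∑ p ∈ Finset.Ioc 0 ⌊√(y / r)⌋₊, (min (s * p) (y / p) - r * p) = S at *
  calc _ ≤ _ := abs_sub_le _ (S / d) _
    _ ≤ 1 / √r * √y + 3 * (√s + √r) * √y := add_le_add hslices ?_
    _ = _ := by ring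
  calc |S / d - Real.log (s / r) / (2 * d) * y| = |(S - y / 2 * Real.log (s / r)) / d| := by
        congr 1
        field_simp
    _ = |S - y / 2 * Real.log (s / r)| / d := by rw [abs_div, Nat.abs_cast]
    _ ≤ _ := (div_le_self (abs_nonneg _) hd1).trans hmain

theorem ncard_sectorPoints_inter_isBigO {d : ℕ} (hd : 0 < d) {r s : ℝ} (hr : 0 < r)
    (hrs : r ≤ s) :
    (fun y : ℝ ↦ ((sectorPoints d r s ∩ {z | (z.1 * z.2 : ℝ) ≤ y}).ncard : ℝ) -
      Real.log (s / r) / (2 * d) * y) =O[atTop] fun y ↦ √y := by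
  refine IsBigO.of_bound (1 / √r + 3 * (√s + √r)) ?_
  filter_upwards [eventually_ge_atTop s] with y hy
  rw [Real.norm_eq_abs, Real.norm_of_nonneg (Real.sqrt_nonneg y)]
  exact abs_ncard_sectorPoints_inter_sub_le hd hr hrs hy

lemma span_pair_eq_top_of_linearIndependent {K V : Type*} [DivisionRing K] [AddCommGroup V]
    [Module K V] (hV : Module.finrank K V = 2) {u v : V} (huv : LinearIndependent K ![u, v]) :
    Submodule.span K {u, v} = ⊤ := by
  rw [← Matrix.range_cons_cons_empty]
  exact huv.span_eq_top_of_card_eq_finrank (by simp [hV])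

section MinimalVectors

variable {E : Type*} [NormedAddCommGroup E] {M : Submodule ℤ E} {a b : E}

lemma norm_eq_of_mem_minimalVectors (ha : a ∈ minimalVectors M) (hb : b ∈ minimalVectors M) :
    ‖a‖ = ‖b‖ :=
  (ha.2.2 b hb.1 hb.2.1).antisymm (hb.2.2 a ha.1 ha.2.1)

variable [NormedSpace ℝ E]

lemma norm_smul_add_smul_lt [StrictConvexSpace ℝ E] (hab : LinearIndependent ℝ ![a, b])
    (hnorm : ‖a‖ = ‖b‖) {s t : ℝ} (hs : |s| ≤ 1 / 2) (ht : |t| ≤ 1 / 2) :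
    ‖s • a + t • b‖ < ‖a‖ := by
  have ha : 0 < ‖a‖ := norm_pos_iff.2 (hab.ne_zero 0)
  have hsa : ‖s • a‖ = |s| * ‖a‖ := norm_smul s a
  have htb : ‖t • b‖ = |t| * ‖a‖ := by rw [norm_smul, hnorm, Real.norm_eq_abs]
  rcases eq_or_ne s 0 with rfl | hs0
  · rw [zero_smul, zero_add, htb]
    nlinarith
  rcases eq_or_ne t 0 with rfl | ht0
  · rw [zero_smul, add_zero, hsa]
    nlinarith
  have hray : ¬SameRay ℝ (s • a) (t • b) := fun h ↦
    sameRay_or_sameRay_neg_iff_not_linearIndependent.1 (Or.inl h)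
      (LinearIndependent.pair_iff.2 fun x y hxy ↦ by
        obtain ⟨hx, hy⟩ := LinearIndependent.pair_iff.1 hab (x * s) (y * t)
          (by rwa [mul_smul, mul_smul])
        exact ⟨(mul_eq_zero_iff_right hs0).1 hx, (mul_eq_zero_iff_right ht0).1 hy⟩)
  calc ‖s • a + t • b‖ < ‖s • a‖ + ‖t • b‖ := norm_add_lt_of_not_sameRay hray
    _ = |s| * ‖a‖ + |t| * ‖a‖ := by rw [hsa, htb]
    _ ≤ ‖a‖ := by nlinarith

lemma IsWellRounded.exists_linearIndependent_minimalVectors (hM : IsWellRounded M)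
    (hE : Module.finrank ℝ E = 2) :
    ∃ a ∈ minimalVectors M, ∃ b ∈ minimalVectors M, LinearIndependent ℝ ![a, b] := by
  have : FiniteDimensional ℝ E := Module.finite_of_finrank_eq_succ hE
  have hrank : 2 = Module.finrank ℝ (Submodule.span ℝ (minimalVectors M)) := by
    rw [hM, finrank_top, hE]
  obtain ⟨v, hmem, -, hv⟩ := Submodule.exists_fun_fin_finrank_span_eq ℝ (minimalVectors M)
  refine ⟨v (Fin.cast hrank 0), hmem _, v (Fin.cast hrank 1), hmem _, ?_⟩
  have hpair : ![v (Fin.cast hrank 0), v (Fin.cast hrank 1)] = v ∘ Fin.cast hrank := by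
    ext i
    fin_cases i <;> rfl
  exact hpair ▸ hv.comp (Fin.cast hrank) (Fin.cast_injective _)

lemma eq_span_pair_of_mem_minimalVectors [StrictConvexSpace ℝ E] (hE : Module.finrank ℝ E = 2)
    (ha : a ∈ minimalVectors M) (hb : b ∈ minimalVectors M)
    (hab : LinearIndependent ℝ ![a, b]) : M = Submodule.span ℤ {a, b} := by
  refine le_antisymm (fun x hx ↦ ?_) (Submodule.span_le.2 (Set.pair_subset ha.1 hb.1))
  obtain ⟨s, t, rfl⟩ := Submodule.mem_span_pair.1
    ((span_pair_eq_top_of_linearIndependent hE hab).ge (Submodule.mem_top (x := x)))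
  have hmem : s • a + t • b - (round s • a + round t • b) ∈ M :=
    M.sub_mem hx (M.add_mem (M.smul_mem _ ha.1) (M.smul_mem _ hb.1))
  have hshort : ‖s • a + t • b - (round s • a + round t • b)‖ < ‖a‖ := by
    convert norm_smul_add_smul_lt hab (norm_eq_of_mem_minimalVectors ha hb)
      (abs_sub_round s) (abs_sub_round t) using 2
    rw [← Int.cast_smul_eq_zsmul ℝ, ← Int.cast_smul_eq_zsmul ℝ]
    module
  have hzero : s • a + t • b - (round s • a + round t • b) = 0 := by
    by_contra hne
    exact hshort.not_ge (ha.2.2 _ hmem hne)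
  exact Submodule.mem_span_pair.2 ⟨round s, round t, (sub_eq_zero.1 hzero).symm⟩

end MinimalVectors

section OrthogonalFrame

variable {E : Type*} [NormedAddCommGroup E] [InnerProductSpace ℝ E]

/-- Two nonzero orthogonal vectors of a Euclidean plane: the axes of a reflection. They are not
normalised, since in the applications they are lattice vectors. -/
structure IsOrthogonalFrame (e f : E) : Prop where
  left_ne : e ≠ 0
  right_ne : f ≠ 0
  inner_eq : inner ℝ e f = 0
  finrank_eq : Module.finrank ℝ E = 2

lemma exists_isOrthogonalFrame (hE : Module.finrank ℝ E = 2) {e : E} (he : e ≠ 0) :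
    ∃ f, IsOrthogonalFrame e f := by
  have hperp : (ℝ ∙ e)ᗮ ≠ ⊥ := by
    rw [Ne, Submodule.orthogonal_eq_bot_iff]
    intro htop
    have hrank := finrank_span_singleton (K := ℝ) he
    rw [htop, finrank_top, hE] at hrank
    norm_num at hrank
  obtain ⟨f, hf, hf0⟩ := Submodule.exists_mem_ne_zero_of_ne_bot hperp
  exact ⟨f, he, hf0, Submodule.mem_orthogonal_singleton_iff_inner_right.1 hf, hE⟩

namespace IsOrthogonalFrame

variable {e f : E}

lemma symm (h : IsOrthogonalFrame e f) : IsOrthogonalFrame f e :=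
  ⟨h.right_ne, h.left_ne, inner_eq_zero_symm.1 h.inner_eq, h.finrank_eq⟩

lemma smul (h : IsOrthogonalFrame e f) {s t : ℝ} (hs : s ≠ 0) (ht : t ≠ 0) :
    IsOrthogonalFrame (s • e) (t • f) :=
  ⟨smul_ne_zero hs h.left_ne, smul_ne_zero ht h.right_ne,
    by rw [real_inner_smul_left, real_inner_smul_right, h.inner_eq, mul_zero, mul_zero],
    h.finrank_eq⟩

lemma linearIndependent (h : IsOrthogonalFrame e f) : LinearIndependent ℝ ![e, f] := by
  refine linearIndependent_of_ne_zero_of_inner_eq_zero (𝕜 := ℝ) ?_ fun i j hij ↦ ?_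
  · exact Fin.forall_fin_two.2 ⟨h.left_ne, h.right_ne⟩
  · fin_cases i <;> fin_cases j <;> first | exact h.inner_eq | exact h.symm.inner_eq | simp at hij

/-- An orthogonal frame as a basis of the plane, used as reference for determinants. -/
noncomputable def basis (h : IsOrthogonalFrame e f) : Module.Basis (Fin 2) ℝ E :=
  basisOfLinearIndependentOfCardEqFinrank h.linearIndependent (by simp [h.finrank_eq])

lemma coe_basis (h : IsOrthogonalFrame e f) : ⇑h.basis = ![e, f] :=
  coe_basisOfLinearIndependentOfCardEqFinrank _ _

lemma exists_coords (h : IsOrthogonalFrame e f) (x : E) : ∃ a b : ℝ, x = a • e + b • f := by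
  refine ⟨h.basis.repr x 0, h.basis.repr x 1, ?_⟩
  simpa [Fin.sum_univ_two, h.coe_basis] using (h.basis.sum_repr x).symm

lemma coords_ext (h : IsOrthogonalFrame e f) {a b c d : ℝ}
    (hx : a • e + b • f = c • e + d • f) : a = c ∧ b = d :=
  LinearIndependent.pair_iffₛ.1 h.linearIndependent a b c d hx

lemma det_basis (h : IsOrthogonalFrame e f) (a b c d : ℝ) :
    h.basis.det ![a • e + b • f, c • e + d • f] = a * d - b * c := by
  have he : h.basis.repr e = Finsupp.single 0 1 := by
    simpa [h.coe_basis] using h.basis.repr_self 0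
  have hf : h.basis.repr f = Finsupp.single 1 1 := by
    simpa [h.coe_basis] using h.basis.repr_self 1
  have hmat : h.basis.toMatrix ![a • e + b • f, c • e + d • f] = !![a, c; b, d] := by
    ext i j
    fin_cases i <;> fin_cases j <;> simp [Module.Basis.toMatrix_apply, he, hf]
  rw [Module.Basis.det_apply, hmat, Matrix.det_fin_two_of, mul_comm b]

lemma exists_basis (h : IsOrthogonalFrame e f) {a b c d : ℝ} (hdet : a * d - b * c ≠ 0) :
    ∃ B : Module.Basis (Fin 2) ℝ E, ⇑B = ![a • e + b • f, c • e + d • f] := by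
  have hB := (Module.Basis.is_basis_iff_det h.basis (v := ![a • e + b • f, c • e + d • f])).2
    (by rw [h.det_basis]; exact hdet.isUnit)
  exact ⟨Module.Basis.mk hB.1 hB.2.ge, Module.Basis.coe_mk _ _⟩

lemma reflection_coords (h : IsOrthogonalFrame e f) (a b : ℝ) :
    (ℝ ∙ e)ᗮ.reflection (a • e + b • f) = -(a • e) + b • f := by
  rw [map_add, map_smul, map_smul, Submodule.reflection_orthogonalComplement_singleton_eq_neg,
    Submodule.reflection_mem_subspace_eq_self
      (Submodule.mem_orthogonal_singleton_iff_inner_right.2 h.inner_eq), smul_neg]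

lemma reflection_symm_apply (h : IsOrthogonalFrame e f) (x : E) :
    (ℝ ∙ f)ᗮ.reflection x = -(ℝ ∙ e)ᗮ.reflection x := by
  obtain ⟨a, b, rfl⟩ := h.exists_coords x
  rw [h.reflection_coords, add_comm, h.symm.reflection_coords]
  abel

end IsOrthogonalFrame

end OrthogonalFrame

section CongruenceLattice

lemma neg_modEq_self_of_dvd_two {d : ℕ} (hd : d ∣ 2) (q : ℤ) : -q ≡ q [ZMOD d] := by
  rw [Int.modEq_iff_dvd, sub_neg_eq_add, ← two_mul]
  exact (Int.natCast_dvd_natCast.2 hd).mul_right q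

lemma abs_modEq_self_of_dvd_two {d : ℕ} (hd : d ∣ 2) (q : ℤ) : |q| ≡ q [ZMOD d] := by
  rcases abs_choice q with hq | hq <;> rw [hq]
  exact neg_modEq_self_of_dvd_two hd q

/-- The lattice of all `p • u + q • v` with `p` and `q` integers congruent modulo `d`. For
orthogonal `u` and `v` it is rectangular for `d = 1`, and for `d = 2` it is the rhombic lattice
generated by `u + v` and `u - v`. -/
def congruenceLattice {E : Type*} [AddCommGroup E] (d : ℕ) (u v : E) : Submodule ℤ E :=
  Submodule.span ℤ {u + v, d • v}

variable {E : Type*} [AddCommGroup E] [Module ℝ E] {d : ℕ} {u v x : E}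

lemma mem_congruenceLattice_iff : x ∈ congruenceLattice d u v ↔
    ∃ p q : ℤ, q ≡ p [ZMOD d] ∧ x = (p : ℝ) • u + (q : ℝ) • v := by
  have hcoords (p n : ℤ) :
      p • (u + v) + n • d • v = (p : ℝ) • u + ((p + d * n : ℤ) : ℝ) • v := by
    simp only [← Int.cast_smul_eq_zsmul ℝ, ← Nat.cast_smul_eq_nsmul ℝ]
    push_cast
    module
  rw [congruenceLattice, Submodule.mem_span_pair]
  constructor
  · rintro ⟨p, n, rfl⟩
    exact ⟨p, p + d * n, (Int.modEq_iff_add_fac.2 ⟨n, rfl⟩).symm, hcoords p n⟩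
  · rintro ⟨p, q, hpq, rfl⟩
    obtain ⟨n, rfl⟩ := Int.modEq_iff_add_fac.1 hpq.symm
    exact ⟨p, n, hcoords p n⟩

lemma congruenceLattice_comm (d : ℕ) (u v : E) :
    congruenceLattice d u v = congruenceLattice d v u := by
  ext x
  rw [mem_congruenceLattice_iff, mem_congruenceLattice_iff, exists_comm]
  simp only [Int.modEq_comm, add_comm]

lemma congruenceLattice_neg_right (hd : d ∣ 2) (u v : E) :
    congruenceLattice d u (-v) = congruenceLattice d u v := by
  ext x
  rw [mem_congruenceLattice_iff, mem_congruenceLattice_iff]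
  constructor <;> rintro ⟨p, q, hpq, rfl⟩ <;>
    exact ⟨p, -q, (neg_modEq_self_of_dvd_two hd q).trans hpq, by simp⟩

lemma congruenceLattice_abs_smul (hd : d ∣ 2) (u v : E) (s t : ℝ) :
    congruenceLattice d (|s| • u) (|t| • v) = congruenceLattice d (s • u) (t • v) := by
  have abs_right (t : ℝ) (u v : E) :
      congruenceLattice d u (|t| • v) = congruenceLattice d u (t • v) := by
    rcases abs_choice t with ht | ht <;> rw [ht]
    rw [neg_smul, congruenceLattice_neg_right hd]
  rw [abs_right, congruenceLattice_comm, abs_right, congruenceLattice_comm]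

lemma span_add_sub_eq_congruenceLattice (u v : E) :
    Submodule.span ℤ {u + v, u - v} = congruenceLattice 2 u v := by
  refine le_antisymm (Submodule.span_le.2 (Set.pair_subset ?_ ?_))
    (Submodule.span_le.2 (Set.pair_subset (Submodule.subset_span (Set.mem_insert _ _)) ?_))
  · exact Submodule.subset_span (Set.mem_insert _ _)
  · exact mem_congruenceLattice_iff.2 ⟨1, -1, by decide, by simp [sub_eq_add_neg]⟩
  · exact Submodule.mem_span_pair.2 ⟨1, -1, by module⟩

lemma congruenceLattice_two_smul_le (hd : d ∣ 2) {p q : ℤ} (hpq : q ≡ p [ZMOD d]) (u v : E) :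
    congruenceLattice 2 ((p : ℝ) • u) ((q : ℝ) • v) ≤ congruenceLattice d u v := by
  refine Submodule.span_le.2 (Set.pair_subset ?_ ?_)
  · exact mem_congruenceLattice_iff.2 ⟨p, q, hpq, rfl⟩
  · refine mem_congruenceLattice_iff.2 ⟨0, 2 * q, ?_, ?_⟩
    · exact Int.modEq_zero_iff_dvd.2 ((Int.natCast_dvd_natCast.2 hd).mul_right q)
    · rw [← Nat.cast_smul_eq_nsmul ℝ]
      push_cast
      module

lemma even_of_even_of_smul_add_smul_mem {K : Submodule ℤ E} {m n : ℤ} (hu : (2 : ℝ) • u ∈ K)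
    (hv : ∀ t : ℝ, t • v ∈ K → ∃ n : ℤ, 2 * n = t) (hx : (m : ℝ) • u + (n : ℝ) • v ∈ K)
    (hm : Even m) : Even n := by
  obtain ⟨k, rfl⟩ := hm
  have hmu : ((k + k : ℤ) : ℝ) • u ∈ K := by
    convert K.smul_mem k hu using 1
    rw [← Int.cast_smul_eq_zsmul ℝ]
    push_cast
    module
  obtain ⟨l, hl⟩ := hv n ((K.add_mem_iff_right hmu).1 hx)
  exact even_iff_two_dvd.2 ⟨l, by exact_mod_cast hl.symm⟩

lemma eq_congruenceLattice_of_le_of_le {K : Submodule ℤ E}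
    (hge : congruenceLattice 1 ((2 : ℝ) • u) ((2 : ℝ) • v) ≤ K)
    (hle : K ≤ congruenceLattice 2 u v) :
    K = congruenceLattice 2 u v ∨ K = congruenceLattice 1 ((2 : ℝ) • u) ((2 : ℝ) • v) := by
  have mem_even (k l : ℤ) : ((2 * k : ℤ) : ℝ) • u + ((2 * l : ℤ) : ℝ) • v ∈
      congruenceLattice 1 ((2 : ℝ) • u) ((2 : ℝ) • v) :=
    mem_congruenceLattice_iff.2 ⟨k, l, by simp [Int.modEq_one], by push_cast; module⟩
  by_cases huv : u + v ∈ K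
  · refine .inl (hle.antisymm (Submodule.span_le.2 (Set.pair_subset huv (hge ?_))))
    convert mem_even 0 1 using 1
    rw [← Nat.cast_smul_eq_nsmul ℝ]
    simp
  · refine .inr (hge.antisymm' fun x hx ↦ ?_)
    obtain ⟨m, n, hmn, rfl⟩ := mem_congruenceLattice_iff.1 (hle hx)
    obtain ⟨j, rfl⟩ := Int.modEq_iff_add_fac.1 hmn.symm
    rcases Int.even_or_odd' m with ⟨k, rfl | rfl⟩
    · convert mem_even k (k + j) using 4
      push_cast
      ring
    · refine absurd ?_ huv
      convert K.sub_mem hx (hge (mem_even k (k + j))) using 1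
      push_cast
      module

end CongruenceLattice

namespace IsOrthogonalFrame

variable {E : Type*} [NormedAddCommGroup E] [InnerProductSpace ℝ E] {e f : E} {d : ℕ}

lemma dvd_of_congruenceLattice_le (h : IsOrthogonalFrame e f) (hd : d ≠ 0) {p q p' q' : ℤ}
    (hq' : q' ≠ 0) (hle : congruenceLattice d ((p : ℝ) • e) ((q : ℝ) • f) ≤
      congruenceLattice d ((p' : ℝ) • e) ((q' : ℝ) • f)) : p' ∣ p := by
  have hmem : ((d * p : ℤ) : ℝ) • e + ((0 : ℤ) : ℝ) • f ∈
      congruenceLattice d ((p' : ℝ) • e) ((q' : ℝ) • f) :=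
    hle (mem_congruenceLattice_iff.2
      ⟨d, 0, (Int.modEq_zero_iff_dvd.2 dvd_rfl).symm, by push_cast; module⟩)
  obtain ⟨m, n, hmod, hmn⟩ := mem_congruenceLattice_iff.1 hmem
  simp only [smul_smul, ← Int.cast_mul] at hmn
  obtain ⟨hp, hq⟩ := h.coords_ext hmn
  obtain rfl : n = 0 := (mul_eq_zero_iff_right hq').1 (Int.cast_inj.1 hq).symm
  obtain ⟨k, rfl⟩ := Int.modEq_zero_iff_dvd.1 hmod.symm
  refine ⟨k, mul_left_cancel₀ (Nat.cast_ne_zero.2 hd) ((Int.cast_inj.1 hp).trans ?_)⟩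
  ring

lemma congruenceLattice_smul_inj (h : IsOrthogonalFrame e f) (hd : d ≠ 0) {p q p' q' : ℤ}
    (hp : 0 < p) (hq : 0 < q) (hp' : 0 < p') (hq' : 0 < q')
    (heq : congruenceLattice d ((p : ℝ) • e) ((q : ℝ) • f) =
      congruenceLattice d ((p' : ℝ) • e) ((q' : ℝ) • f)) : p = p' ∧ q = q' := by
  have heq' := heq
  rw [congruenceLattice_comm, congruenceLattice_comm d ((p' : ℝ) • e)] at heq'
  exact ⟨Int.dvd_antisymm hp.le hp'.le (h.dvd_of_congruenceLattice_le hd hq.ne' heq.ge)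
      (h.dvd_of_congruenceLattice_le hd hq'.ne' heq.le),
    Int.dvd_antisymm hq.le hq'.le (h.symm.dvd_of_congruenceLattice_le hd hp.ne' heq'.ge)
      (h.symm.dvd_of_congruenceLattice_le hd hp'.ne' heq'.le)⟩

lemma exists_basis_congruenceLattice (h : IsOrthogonalFrame e f) (hd : d ≠ 0) {s t : ℝ}
    (hs : s ≠ 0) (ht : t ≠ 0) : ∃ B : Module.Basis (Fin 2) ℝ E,
      Submodule.span ℤ (Set.range B) = congruenceLattice d (s • e) (t • f) ∧
      h.basis.det B = d * s * t := by
  obtain ⟨B, hB⟩ := h.exists_basis (a := s) (b := t) (c := 0) (d := d * t) (by simp [hd, hs, ht])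
  refine ⟨B, ?_, ?_⟩
  · rw [hB, Matrix.range_cons_cons_empty, zero_smul, zero_add, mul_smul, Nat.cast_smul_eq_nsmul]
    rfl
  · rw [hB, h.det_basis]
    ring

end IsOrthogonalFrame

section Index

variable {E : Type*} [NormedAddCommGroup E] [InnerProductSpace ℝ E] [FiniteDimensional ℝ E]

open ZLattice MeasureTheory in
lemma relIndex_span_range_basis {ι : Type*} [Fintype ι] [DecidableEq ι]
    (b₀ b₁ b₂ : Module.Basis ι ℝ E)
    (h : Submodule.span ℤ (Set.range b₁) ≤ Submodule.span ℤ (Set.range b₂)) :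
    ((Submodule.span ℤ (Set.range b₁)).toAddSubgroup.relIndex
      (Submodule.span ℤ (Set.range b₂)).toAddSubgroup : ℝ) = |b₀.det b₁| / |b₀.det b₂| := by
  have coe_restrictScalars (b : Module.Basis ι ℝ E) :
      ((↑) : Submodule.span ℤ (Set.range b) → E) ∘ ⇑(b.restrictScalars ℤ) = b :=
    funext fun i ↦ b.restrictScalars_apply ℤ i
  borelize E
  rw [← covolume_div_covolume_eq_relIndex' _ _ h,
    covolume_eq_det_mul_measureReal _ _ (b₁.restrictScalars ℤ) b₀,
    covolume_eq_det_mul_measureReal _ _ (b₂.restrictScalars ℤ) b₀,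
    coe_restrictScalars, coe_restrictScalars]
  refine mul_div_mul_right _ _ ?_
  rw [measureReal_ne_zero_iff
    (Bornology.IsBounded.measure_lt_top (ZSpan.fundamentalDomain_isBounded _)).ne]
  exact ZSpan.measure_fundamentalDomain_ne_zero _

lemma IsCoincidenceIsometry.coincidenceIndex_ne_zero {L : Submodule ℤ E} [DiscreteTopology L]
    {R : E ≃ₗᵢ[ℝ] E} (hR : IsCoincidenceIsometry L R) : coincidenceIndex L R ≠ 0 := by
  have hle : cslOf L R ≤ L := inf_le_left
  have : DiscreteTopology (cslOf L R) := DiscreteTopology.of_subset ‹_› hle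
  have : IsZLattice ℝ (cslOf L R) := ⟨hR⟩
  have : IsZLattice ℝ L := ⟨top_le_iff.1 (hR.ge.trans (Submodule.span_mono hle))⟩
  borelize E
  have hcovol : ZLattice.covolume (cslOf L R) / ZLattice.covolume L ≠ 0 :=
    div_ne_zero (ZLattice.covolume_ne_zero _ _) (ZLattice.covolume_ne_zero _ _)
  rw [ZLattice.covolume_div_covolume_eq_relIndex' _ _ hle] at hcovol
  exact Nat.cast_ne_zero.1 hcovol

end Index

lemma IsOrthogonalFrame.latticeIndex_congruenceLattice {E : Type*} [NormedAddCommGroup E]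
    [InnerProductSpace ℝ E] {e f : E} (h : IsOrthogonalFrame e f) {c d : ℕ} (hc : c ≠ 0)
    (hd : d ≠ 0) {s t : ℝ} (hs : s ≠ 0) (ht : t ≠ 0)
    (hle : congruenceLattice c (s • e) (t • f) ≤ congruenceLattice d e f) :
    (latticeIndex (congruenceLattice d e f) (congruenceLattice c (s • e) (t • f)) : ℝ) =
      c * |s * t| / d := by
  have : FiniteDimensional ℝ E := Module.finite_of_finrank_eq_succ h.finrank_eq
  obtain ⟨B, hB, hB_det⟩ := h.exists_basis_congruenceLattice hc hs ht
  obtain ⟨B', hB', hB'_det⟩ := h.exists_basis_congruenceLattice hd one_ne_zero one_ne_zero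
  rw [one_smul, one_smul] at hB'
  rw [← hB, ← hB'] at hle ⊢
  rw [latticeIndex, relIndex_span_range_basis h.basis _ _ hle, hB_det, hB'_det, mul_assoc, abs_mul,
    mul_one, mul_one, Nat.abs_cast, Nat.abs_cast]

section WellRounded

lemma norm_le_sqrt_three_mul_norm_iff {E : Type*} [NormedAddCommGroup E] {u v : E} :
    ‖u‖ ≤ √3 * ‖v‖ ↔ ‖u‖ ^ 2 ≤ 3 * ‖v‖ ^ 2 := by
  rw [← pow_le_pow_iff_left₀ (norm_nonneg u) (by positivity) two_ne_zero, mul_pow,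
    Real.sq_sqrt zero_le_three]

variable {E : Type*} [NormedAddCommGroup E] [InnerProductSpace ℝ E] {u v : E}

lemma norm_smul_add_smul_sq_of_inner_eq_zero (huv : inner ℝ u v = 0) (s t : ℝ) :
    ‖s • u + t • v‖ ^ 2 = s ^ 2 * ‖u‖ ^ 2 + t ^ 2 * ‖v‖ ^ 2 := by
  rw [sq, norm_add_sq_eq_norm_sq_add_norm_sq_real
    (by rw [real_inner_smul_left, real_inner_smul_right, huv, mul_zero, mul_zero]),
    ← sq, ← sq, norm_smul, norm_smul, mul_pow, mul_pow, Real.norm_eq_abs, Real.norm_eq_abs,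
    sq_abs, sq_abs]

lemma add_le_sq_mul_add_sq_mul {p q : ℤ} (hpq : q ≡ p [ZMOD 2]) (hne : p ≠ 0 ∨ q ≠ 0) {x y : ℝ}
    (hx : 0 ≤ x) (hy : 0 ≤ y) (hxy : x ≤ 3 * y) (hyx : y ≤ 3 * x) :
    x + y ≤ p ^ 2 * x + q ^ 2 * y := by
  have one_le_sq {n : ℤ} (hn : n ≠ 0) : (1 : ℝ) ≤ n ^ 2 := by
    exact_mod_cast Int.add_one_le_iff.2 (sq_pos_of_ne_zero hn)
  -- In the even case the right-hand side is at least `4 * x` or `4 * y`.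
  rcases Int.even_or_odd' p with ⟨m, rfl | rfl⟩
  · obtain ⟨n, rfl⟩ : (2 : ℤ) ∣ q := by
      rw [← Int.modEq_zero_iff_dvd]
      exact hpq.trans (Int.modEq_zero_iff_dvd.2 ⟨m, rfl⟩)
    push_cast
    rcases hne with hm | hn
    · nlinarith [one_le_sq (right_ne_zero_of_mul hm), mul_nonneg (sq_nonneg (n : ℝ)) hy]
    · nlinarith [one_le_sq (right_ne_zero_of_mul hn), mul_nonneg (sq_nonneg (m : ℝ)) hx]
  · have hq : q ≠ 0 := by
      rintro rfl
      have := Int.ModEq.dvd hpq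
      omega
    nlinarith [one_le_sq hq, one_le_sq (n := 2 * m + 1) (by omega)]

lemma add_mem_minimalVectors_congruenceLattice_two (huv : inner ℝ u v = 0) (hu : u ≠ 0)
    (hle : ‖u‖ ≤ √3 * ‖v‖) (hge : ‖v‖ ≤ √3 * ‖u‖) :
    u + v ∈ minimalVectors (congruenceLattice 2 u v) := by
  have hadd : ‖u + v‖ ^ 2 = ‖u‖ ^ 2 + ‖v‖ ^ 2 := by
    simpa using norm_smul_add_smul_sq_of_inner_eq_zero huv 1 1
  refine ⟨Submodule.subset_span (Set.mem_insert _ _), fun h ↦ ?_, fun w hw hw0 ↦ ?_⟩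
  · rw [h, norm_zero] at hadd
    nlinarith [norm_pos_iff.2 hu]
  · obtain ⟨p, q, hpq, rfl⟩ := mem_congruenceLattice_iff.1 hw
    have hne : p ≠ 0 ∨ q ≠ 0 := by
      by_contra! h
      exact hw0 (by simp [h.1, h.2])
    refine le_of_sq_le_sq ?_ (norm_nonneg _)
    rw [hadd, norm_smul_add_smul_sq_of_inner_eq_zero huv]
    exact add_le_sq_mul_add_sq_mul hpq hne (sq_nonneg _) (sq_nonneg _)
      (norm_le_sqrt_three_mul_norm_iff.1 hle) (norm_le_sqrt_three_mul_norm_iff.1 hge)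

lemma norm_le_sqrt_three_mul_norm_of_mem_minimalVectors {M : Submodule ℤ E}
    (huv : inner ℝ u v = 0) (hu : u ≠ 0) (hadd : u + v ∈ minimalVectors M) (hsub : u - v ∈ M) :
    ‖v‖ ≤ √3 * ‖u‖ := by
  have hmin := hadd.2.2 ((2 : ℝ) • u)
    (by convert M.add_mem hadd.1 hsub using 1; module) (smul_ne_zero two_ne_zero hu)
  have hadd_sq := norm_smul_add_smul_sq_of_inner_eq_zero huv 1 1
  rw [one_smul, one_smul] at hadd_sq
  rw [norm_smul, Real.norm_two] at hmin
  rw [norm_le_sqrt_three_mul_norm_iff]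
  nlinarith [norm_nonneg (u + v)]

lemma IsOrthogonalFrame.isWellRounded_congruenceLattice_two (h : IsOrthogonalFrame u v)
    (hle : ‖u‖ ≤ √3 * ‖v‖) (hge : ‖v‖ ≤ √3 * ‖u‖) : IsWellRounded (congruenceLattice 2 u v) := by
  have hadd := add_mem_minimalVectors_congruenceLattice_two h.inner_eq h.left_ne hle hge
  have hsub : u - v ∈ minimalVectors (congruenceLattice 2 u v) := by
    rw [← congruenceLattice_neg_right dvd_rfl, sub_eq_add_neg]
    exact add_mem_minimalVectors_congruenceLattice_two
      (by rw [inner_neg_right, h.inner_eq, neg_zero]) h.left_ne (by rwa [norm_neg])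
      (by rwa [norm_neg])
  obtain ⟨B, hB⟩ := h.exists_basis (a := 1) (b := 1) (c := 1) (d := -1) (by norm_num)
  rw [IsWellRounded, eq_top_iff, ← B.span_eq, hB, Matrix.range_cons_cons_empty]
  refine Submodule.span_mono (Set.pair_subset ?_ ?_)
  · simpa using hadd
  · simpa [sub_eq_add_neg] using hsub

end WellRounded

section Coincidence

variable {E : Type*} [NormedAddCommGroup E] [InnerProductSpace ℝ E]

section Reflection

variable {L : Submodule ℤ E} {U : Submodule ℝ E} [U.HasOrthogonalProjection] {x : E}

lemma mem_cslOf_reflection : x ∈ cslOf L U.reflection ↔ x ∈ L ∧ U.reflection x ∈ L := by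
  rw [cslOf, Submodule.mem_inf]
  refine and_congr_right fun _ ↦ ?_
  rw [Submodule.mem_map]
  constructor
  · rintro ⟨y, hy, rfl⟩
    simpa using hy
  · exact fun hx ↦ ⟨_, hx, by simp⟩

lemma reflection_mem_cslOf (hx : x ∈ cslOf L U.reflection) :
    U.reflection x ∈ cslOf L U.reflection := by
  rw [mem_cslOf_reflection] at hx ⊢
  exact ⟨hx.2, by simpa using hx.1⟩

end Reflection

lemma isCoincidenceIsometry_reflection_sub (hE : Module.finrank ℝ E = 2) {L : Submodule ℤ E}
    {a b : E} (ha : a ∈ L) (hb : b ∈ L) (hnorm : ‖a‖ = ‖b‖)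
    (hab : LinearIndependent ℝ ![a, b]) :
    IsCoincidenceIsometry L (ℝ ∙ (a - b))ᗮ.reflection := by
  have hb_refl : (ℝ ∙ (a - b))ᗮ.reflection a = b := Submodule.reflection_sub hnorm
  have ha_csl : a ∈ cslOf L (ℝ ∙ (a - b))ᗮ.reflection :=
    mem_cslOf_reflection.2 ⟨ha, by rwa [hb_refl]⟩
  have hb_csl : b ∈ cslOf L (ℝ ∙ (a - b))ᗮ.reflection := by
    simpa only [hb_refl] using reflection_mem_cslOf ha_csl
  rw [IsCoincidenceIsometry, eq_top_iff, ← span_pair_eq_top_of_linearIndependent hE hab]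
  exact Submodule.span_mono (Set.pair_subset ha_csl hb_csl)

lemma exists_forall_smul_mem_iff (K : Submodule ℤ E) [DiscreteTopology K] {e : E} (he : e ≠ 0) :
    ∃ s : ℝ, ∀ t : ℝ, t • e ∈ K ↔ ∃ n : ℤ, n * s = t := by
  let H : AddSubgroup ℝ := K.toAddSubgroup.comap (LinearMap.toSpanSingleton ℝ E e).toAddMonoidHom
  have : DiscreteTopology H := by
    refine DiscreteTopology.preimage_of_continuous_injective (K : Set E) ?_
      (smul_left_injective ℝ he)
    exact continuous_id.smul continuous_const
  obtain ⟨s, hs⟩ := AddSubgroup.discrete_iff_addCyclic.2 this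
  refine ⟨s, fun t ↦ ⟨fun ht ↦ ?_, ?_⟩⟩
  · obtain ⟨n, hn⟩ := AddSubgroup.mem_zmultiples_iff.1 (hs ⟨t, ht⟩)
    exact ⟨n, by simpa using congrArg Subtype.val hn⟩
  · rintro ⟨n, rfl⟩
    rw [← zsmul_eq_mul]
    exact H.zsmul_mem s.2 n

namespace IsOrthogonalFrame

variable {e f : E} {K : Submodule ℤ E}

lemma cslOf_symm (h : IsOrthogonalFrame e f) (L : Submodule ℤ E) :
    cslOf L (ℝ ∙ f)ᗮ.reflection = cslOf L (ℝ ∙ e)ᗮ.reflection := by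
  ext x
  rw [mem_cslOf_reflection, mem_cslOf_reflection, h.reflection_symm_apply, neg_mem_iff]

lemma reflection_symm_mem (h : IsOrthogonalFrame e f)
    (hinv : ∀ x ∈ K, (ℝ ∙ e)ᗮ.reflection x ∈ K) (x : E) (hx : x ∈ K) :
    (ℝ ∙ f)ᗮ.reflection x ∈ K := by
  rw [h.reflection_symm_apply]
  exact K.neg_mem (hinv x hx)

lemma two_mul_smul_mem (h : IsOrthogonalFrame e f) (hinv : ∀ x ∈ K, (ℝ ∙ e)ᗮ.reflection x ∈ K)
    {a b : ℝ} (hx : a • e + b • f ∈ K) : (2 * a) • e ∈ K := by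
  convert K.sub_mem hx (hinv _ hx) using 1
  rw [h.reflection_coords]
  module

lemma exists_smul_mem_iff_even (h : IsOrthogonalFrame e f) [DiscreteTopology K]
    (hspan : Submodule.span ℝ (K : Set E) = ⊤) (hinv : ∀ x ∈ K, (ℝ ∙ e)ᗮ.reflection x ∈ K) :
    ∃ s : ℝ, s ≠ 0 ∧ ∀ t : ℝ, t • s • e ∈ K ↔ ∃ n : ℤ, 2 * n = t := by
  obtain ⟨s, hs⟩ := exists_forall_smul_mem_iff K h.left_ne
  have hs0 : s ≠ 0 := by
    rintro rfl
    have hle : Submodule.span ℝ (K : Set E) ≤ ℝ ∙ f := by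
      refine Submodule.span_le.2 fun x hx ↦ ?_
      obtain ⟨a, b, rfl⟩ := h.exists_coords x
      obtain ⟨n, hn⟩ := (hs _).1 (h.two_mul_smul_mem hinv hx)
      obtain rfl : a = 0 := by linarith
      simpa using Submodule.smul_mem _ b (Submodule.mem_span_singleton_self f)
    obtain ⟨b, hb⟩ := Submodule.mem_span_singleton.1 (hle (hspan ▸ Submodule.mem_top (x := e)))
    have := h.coords_ext (a := 0) (b := b) (c := 1) (d := 0) (by simpa using hb)
    exact zero_ne_one this.1
  refine ⟨s / 2, by positivity, fun t ↦ ?_⟩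
  rw [smul_smul, hs]
  refine exists_congr fun n ↦ ?_
  rw [mul_div_assoc', eq_div_iff two_ne_zero, mul_right_comm, mul_left_inj' hs0, mul_comm]

lemma le_congruenceLattice_two (h : IsOrthogonalFrame e f)
    (hinv : ∀ x ∈ K, (ℝ ∙ e)ᗮ.reflection x ∈ K)
    (he : ∀ t : ℝ, t • e ∈ K ↔ ∃ n : ℤ, 2 * n = t)
    (hf : ∀ t : ℝ, t • f ∈ K ↔ ∃ n : ℤ, 2 * n = t) : K ≤ congruenceLattice 2 e f := by
  intro x hx
  obtain ⟨a, b, rfl⟩ := h.exists_coords x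
  have hx_symm := hx
  rw [add_comm] at hx_symm
  obtain ⟨m, hm⟩ := (he _).1 (h.two_mul_smul_mem hinv hx)
  obtain ⟨n, hn⟩ := (hf _).1 (h.symm.two_mul_smul_mem (h.reflection_symm_mem hinv) hx_symm)
  obtain rfl : (m : ℝ) = a := by linarith
  obtain rfl : (n : ℝ) = b := by linarith
  have two_smul_mem {u : E} (hu : ∀ t : ℝ, t • u ∈ K ↔ ∃ n : ℤ, 2 * n = t) : (2 : ℝ) • u ∈ K :=
    (hu 2).2 ⟨1, by simp⟩
  have hparity : Even m ↔ Even n :=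
    ⟨even_of_even_of_smul_add_smul_mem (two_smul_mem he) (fun t ↦ (hf t).1) hx,
      even_of_even_of_smul_add_smul_mem (two_smul_mem hf) (fun t ↦ (he t).1) hx_symm⟩
  exact mem_congruenceLattice_iff.2
    ⟨m, n, Int.modEq_iff_dvd.2 (even_iff_two_dvd.1 (Int.even_sub.2 hparity)), rfl⟩

lemma exists_eq_congruenceLattice (h : IsOrthogonalFrame e f) [DiscreteTopology K]
    (hspan : Submodule.span ℝ (K : Set E) = ⊤) (hinv : ∀ x ∈ K, (ℝ ∙ e)ᗮ.reflection x ∈ K) :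
    ∃ (d : ℕ) (s t : ℝ), d ∣ 2 ∧ s ≠ 0 ∧ t ≠ 0 ∧ K = congruenceLattice d (s • e) (t • f) := by
  obtain ⟨s, hs, hse⟩ := h.exists_smul_mem_iff_even hspan hinv
  obtain ⟨t, ht, htf⟩ := h.symm.exists_smul_mem_iff_even hspan (h.reflection_symm_mem hinv)
  have hinv' : ∀ x ∈ K, (ℝ ∙ (s • e))ᗮ.reflection x ∈ K := by
    simpa only [Submodule.span_singleton_smul_eq hs.isUnit] using hinv
  have hse₂ : (2 : ℝ) • s • e ∈ K := (hse 2).2 ⟨1, by simp⟩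
  have htf₂ : (2 : ℝ) • t • f ∈ K := (htf 2).2 ⟨1, by simp⟩
  have hge : congruenceLattice 1 ((2 : ℝ) • s • e) ((2 : ℝ) • t • f) ≤ K :=
    Submodule.span_le.2 (Set.pair_subset (K.add_mem hse₂ htf₂) (by rwa [one_smul]))
  rcases eq_congruenceLattice_of_le_of_le hge
    ((h.smul hs ht).le_congruenceLattice_two hinv' hse htf) with hK | hK
  · exact ⟨2, s, t, dvd_rfl, hs, ht, hK⟩
  · exact ⟨1, 2 * s, 2 * t, one_dvd 2, by positivity, by positivity,
      by rwa [mul_smul, mul_smul]⟩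

end IsOrthogonalFrame

end Coincidence

section CoincidenceFrame

variable {E : Type*} [NormedAddCommGroup E] [InnerProductSpace ℝ E]

/-- The axes `ℝ e` and `ℝ f` of the two coincidence reflections of a planar lattice `L`, with `e`
and `f` scaled so that the common lattice `L ∩ R L` of both reflections is
`congruenceLattice d e f` for a divisor `d` of `2`. -/
structure IsCoincidenceFrame (L : Submodule ℤ E) (d : ℕ) (e f : E) : Prop
    extends IsOrthogonalFrame e f where
  dvd_two : d ∣ 2
  cslOf_eq : cslOf L (ℝ ∙ e)ᗮ.reflection = congruenceLattice d e f
  eq_or_eq : ∀ R, IsCoincidenceReflection L R → R = (ℝ ∙ e)ᗮ.reflection ∨ R = (ℝ ∙ f)ᗮ.reflection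

lemma IsOrthogonalFrame.eq_reflection_of_encard_eq_two {e f : E} (h : IsOrthogonalFrame e f)
    {L : Submodule ℤ E} (he : IsCoincidenceIsometry L (ℝ ∙ e)ᗮ.reflection)
    (h2 : {R : E ≃ₗᵢ[ℝ] E | IsCoincidenceReflection L R}.encard = 2) (R : E ≃ₗᵢ[ℝ] E)
    (hR : IsCoincidenceReflection L R) :
    R = (ℝ ∙ e)ᗮ.reflection ∨ R = (ℝ ∙ f)ᗮ.reflection := by
  have hne : (ℝ ∙ e)ᗮ.reflection ≠ (ℝ ∙ f)ᗮ.reflection := by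
    intro heq
    have hneg := h.reflection_symm_apply e
    rw [← heq, eq_neg_iff_add_eq_zero, ← two_smul ℝ, smul_eq_zero_iff_right two_ne_zero,
      LinearIsometryEquiv.map_eq_zero_iff] at hneg
    exact h.left_ne hneg
  have hf : IsCoincidenceIsometry L (ℝ ∙ f)ᗮ.reflection := by
    rwa [IsCoincidenceIsometry, h.cslOf_symm]
  have heq : {(ℝ ∙ e)ᗮ.reflection, (ℝ ∙ f)ᗮ.reflection} = {R | IsCoincidenceReflection L R} := by
    refine (Set.toFinite _).eq_of_subset_of_encard_le (Set.pair_subset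
      ⟨⟨e, h.left_ne, rfl⟩, he⟩ ⟨⟨f, h.right_ne, rfl⟩, hf⟩) ?_
    rw [h2, Set.encard_pair hne]
  exact heq.ge hR

lemma exists_isCoincidenceFrame (hE : Module.finrank ℝ E = 2) (L : Submodule ℤ E)
    [DiscreteTopology L] (h2 : {R : E ≃ₗᵢ[ℝ] E | IsCoincidenceReflection L R}.encard = 2) :
    ∃ d e f, IsCoincidenceFrame L d e f := by
  obtain ⟨R, ⟨u, hu, rfl⟩, hspan⟩ : {R : E ≃ₗᵢ[ℝ] E | IsCoincidenceReflection L R}.Nonempty := by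
    rw [← Set.encard_ne_zero, h2]
    exact two_ne_zero
  obtain ⟨v, h⟩ := exists_isOrthogonalFrame hE hu
  have : DiscreteTopology (cslOf L (ℝ ∙ u)ᗮ.reflection) :=
    DiscreteTopology.of_subset ‹_› (inf_le_left : cslOf L (ℝ ∙ u)ᗮ.reflection ≤ L)
  obtain ⟨d, s, t, hd, hs, ht, hK⟩ :=
    h.exists_eq_congruenceLattice hspan fun _ ↦ reflection_mem_cslOf
  have heq := h.eq_reflection_of_encard_eq_two hspan h2
  refine ⟨d, s • u, t • v, h.smul hs ht, hd, ?_, ?_⟩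
  · simpa only [Submodule.span_singleton_smul_eq hs.isUnit] using hK
  · simpa only [Submodule.span_singleton_smul_eq hs.isUnit,
      Submodule.span_singleton_smul_eq ht.isUnit] using heq

/-- The lattice generated by the sides of the rhombus with half diagonals `p • e` and `q • f`, where
`z = (p, q)`. -/
def rhombicLattice (e f : E) (z : ℤ × ℤ) : Submodule ℤ E :=
  congruenceLattice 2 ((z.1 : ℝ) • e) ((z.2 : ℝ) • f)

/-- The parameters of the well-rounded rhombic lattices: the sector says that neither diagonal of
the rhombus is longer than `√3` times the other. -/
noncomputable def wellRoundedCoords (d : ℕ) (e f : E) : Set (ℤ × ℤ) :=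
  sectorPoints d (‖e‖ / (√3 * ‖f‖)) (√3 * ‖e‖ / ‖f‖)

lemma mem_wellRoundedCoords_iff {d : ℕ} {e f : E} (hf : f ≠ 0) {z : ℤ × ℤ} :
    z ∈ wellRoundedCoords d e f ↔ 0 < z.1 ∧ 0 < z.2 ∧ z.2 ≡ z.1 [ZMOD d] ∧
      ‖(z.1 : ℝ) • e‖ ≤ √3 * ‖(z.2 : ℝ) • f‖ ∧ ‖(z.2 : ℝ) • f‖ ≤ √3 * ‖(z.1 : ℝ) • e‖ := by
  have hf' : 0 < ‖f‖ := norm_pos_iff.2 hf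
  refine and_congr_right fun h₁ ↦ and_congr_right fun h₂ ↦ and_congr_right fun _ ↦ ?_
  rw [norm_smul, norm_smul, Real.norm_of_nonneg (Int.cast_nonneg h₁.le),
    Real.norm_of_nonneg (Int.cast_nonneg h₂.le), div_mul_eq_mul_div, div_mul_eq_mul_div,
    div_le_iff₀ (by positivity), le_div_iff₀ hf']
  refine and_congr (iff_of_eq ?_) (iff_of_eq ?_) <;> congr 1 <;> ring

end CoincidenceFrame

namespace IsCoincidenceFrame

variable {E : Type*} [NormedAddCommGroup E] [InnerProductSpace ℝ E] {L M : Submodule ℤ E} {d : ℕ}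
  {e f : E}

lemma pos (h : IsCoincidenceFrame L d e f) : 0 < d :=
  Nat.pos_of_dvd_of_pos h.dvd_two two_pos

lemma congruenceLattice_le (h : IsCoincidenceFrame L d e f) : congruenceLattice d e f ≤ L :=
  h.cslOf_eq.ge.trans inf_le_left

lemma coincidenceIndex_ne_zero [DiscreteTopology L] (h : IsCoincidenceFrame L d e f) :
    coincidenceIndex L (ℝ ∙ e)ᗮ.reflection ≠ 0 := by
  have : FiniteDimensional ℝ E := Module.finite_of_finrank_eq_succ h.finrank_eq
  refine IsCoincidenceIsometry.coincidenceIndex_ne_zero ?_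
  obtain ⟨B, hB, -⟩ := h.exists_basis_congruenceLattice h.pos.ne' one_ne_zero one_ne_zero
  rw [IsCoincidenceIsometry, h.cslOf_eq, ← one_smul ℝ e, ← one_smul ℝ f, ← hB,
    Submodule.span_span_of_tower, B.span_eq]

lemma coincidenceIndex_eq (h : IsCoincidenceFrame L d e f) {R : E ≃ₗᵢ[ℝ] E}
    (hR : IsCoincidenceReflection L R) :
    coincidenceIndex L R = coincidenceIndex L (ℝ ∙ e)ᗮ.reflection := by
  rcases h.eq_or_eq R hR with rfl | rfl
  · rfl
  · rw [coincidenceIndex, h.cslOf_symm, coincidenceIndex]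

lemma exists_minimalVectors_eq_span_reflection (h : IsCoincidenceFrame L d e f) (hML : M ≤ L)
    (hM : IsWellRounded M) : ∃ a ∈ minimalVectors M,
      LinearIndependent ℝ ![a, (ℝ ∙ e)ᗮ.reflection a] ∧
      M = Submodule.span ℤ {a, (ℝ ∙ e)ᗮ.reflection a} := by
  obtain ⟨a, ha, b, hb, hab⟩ := hM.exists_linearIndependent_minimalVectors h.finrank_eq
  have hnorm := norm_eq_of_mem_minimalVectors ha hb
  have hb_eq : b = (ℝ ∙ (a - b))ᗮ.reflection a := (Submodule.reflection_sub hnorm).symm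
  have hsub : a - b ≠ 0 := by
    intro hzero
    rw [sub_eq_zero] at hzero
    exact absurd (hab.injective (a₁ := 0) (a₂ := 1) hzero) zero_ne_one
  refine ⟨a, ha, ?_⟩
  rcases h.eq_or_eq _ ⟨⟨_, hsub, rfl⟩, isCoincidenceIsometry_reflection_sub h.finrank_eq
    (hML ha.1) (hML hb.1) hnorm hab⟩ with hR | hR
  · rw [hR] at hb_eq
    rw [← hb_eq]
    exact ⟨hab, eq_span_pair_of_mem_minimalVectors h.finrank_eq ha hb hab⟩
  · rw [hR, h.reflection_symm_apply] at hb_eq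
    have hb' : -b ∈ minimalVectors M :=
      ⟨M.neg_mem hb.1, neg_ne_zero.2 hb.2.1, by simpa only [norm_neg] using hb.2.2⟩
    have hab' : LinearIndependent ℝ ![a, -b] := LinearIndependent.pair_neg_right_iff.2 hab
    rw [← neg_eq_iff_eq_neg.2 hb_eq]
    exact ⟨hab', eq_span_pair_of_mem_minimalVectors h.finrank_eq ha hb' hab'⟩

lemma exists_eq_rhombicLattice (h : IsCoincidenceFrame L d e f) (hML : M ≤ L)
    (hM : IsWellRounded M) : ∃ z ∈ wellRoundedCoords d e f, rhombicLattice e f z = M := by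
  obtain ⟨a, ha, hab, hspan⟩ := h.exists_minimalVectors_eq_span_reflection hML hM
  have hRa : (ℝ ∙ e)ᗮ.reflection a ∈ M :=
    hspan ▸ Submodule.subset_span (Set.mem_insert_of_mem _ rfl)
  have hcsl : a ∈ congruenceLattice d e f :=
    h.cslOf_eq ▸ mem_cslOf_reflection.2 ⟨hML ha.1, hML hRa⟩
  obtain ⟨p, q, hpq, rfl⟩ := mem_congruenceLattice_iff.1 hcsl
  rw [h.reflection_coords, neg_add_eq_sub] at hab hspan hRa
  have hp : p ≠ 0 := by
    rintro rfl
    exact one_ne_zero (LinearIndependent.pair_iff.1 hab 1 (-1) (by simp)).1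
  have hq : q ≠ 0 := by
    rintro rfl
    exact one_ne_zero (LinearIndependent.pair_iff.1 hab 1 1 (by simp)).1
  have hframe := h.smul (Int.cast_ne_zero.2 hp) (Int.cast_ne_zero.2 hq)
  have hle := norm_le_sqrt_three_mul_norm_of_mem_minimalVectors hframe.inner_eq hframe.left_ne ha
    (by simpa only [neg_sub] using M.neg_mem hRa)
  have hge := norm_le_sqrt_three_mul_norm_of_mem_minimalVectors hframe.symm.inner_eq
    hframe.right_ne (by rwa [add_comm]) hRa
  rw [add_comm, span_add_sub_eq_congruenceLattice, congruenceLattice_comm] at hspan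
  refine ⟨(|p|, |q|), (mem_wellRoundedCoords_iff h.right_ne).2
    ⟨abs_pos.2 hp, abs_pos.2 hq, ?_, ?_, ?_⟩, ?_⟩
  · exact (abs_modEq_self_of_dvd_two h.dvd_two q).trans
      (hpq.trans (abs_modEq_self_of_dvd_two h.dvd_two p).symm)
  · simpa only [Int.cast_abs, norm_smul, norm_abs_eq_norm] using hge
  · simpa only [Int.cast_abs, norm_smul, norm_abs_eq_norm] using hle
  · simp only [rhombicLattice, Int.cast_abs, congruenceLattice_abs_smul dvd_rfl, ← hspan]

lemma image_wellRoundedCoords (h : IsCoincidenceFrame L d e f) :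
    rhombicLattice e f '' wellRoundedCoords d e f = {M | M ≤ L ∧ IsWellRounded M} := by
  refine Set.Subset.antisymm ?_ fun M hM ↦ h.exists_eq_rhombicLattice hM.1 hM.2
  rintro _ ⟨z, hz, rfl⟩
  obtain ⟨hp, hq, hpq, hle, hge⟩ := (mem_wellRoundedCoords_iff h.right_ne).1 hz
  have hframe := h.smul (Int.cast_ne_zero.2 hp.ne') (Int.cast_ne_zero.2 hq.ne')
  exact ⟨(congruenceLattice_two_smul_le h.dvd_two hpq e f).trans h.congruenceLattice_le,
    hframe.isWellRounded_congruenceLattice_two hle hge⟩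

lemma injOn_rhombicLattice (h : IsCoincidenceFrame L d e f) :
    Set.InjOn (rhombicLattice e f) (wellRoundedCoords d e f) := fun _ hz _ hz' heq ↦
  Prod.ext_iff.2 (h.congruenceLattice_smul_inj two_ne_zero hz.1 hz.2.1 hz'.1 hz'.2.1 heq)

lemma latticeIndex_rhombicLattice (h : IsCoincidenceFrame L d e f) {z : ℤ × ℤ}
    (hz : z ∈ wellRoundedCoords d e f) : (latticeIndex L (rhombicLattice e f z) : ℝ) =
      2 * (z.1 * z.2) / d * coincidenceIndex L (ℝ ∙ e)ᗮ.reflection := by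
  obtain ⟨hp, hq, hpq, -⟩ := hz
  have hle := congruenceLattice_two_smul_le h.dvd_two hpq e f
  have hpos : (0 : ℝ) < z.1 * z.2 := mul_pos (Int.cast_pos.2 hp) (Int.cast_pos.2 hq)
  have hindex := h.latticeIndex_congruenceLattice two_ne_zero h.pos.ne'
    (Int.cast_ne_zero.2 hp.ne') (Int.cast_ne_zero.2 hq.ne') hle
  rw [abs_of_pos hpos, Nat.cast_two] at hindex
  rw [coincidenceIndex, h.cslOf_eq, ← hindex, ← Nat.cast_mul]
  exact congrArg _ (AddSubgroup.relIndex_mul_relIndex _ _ _ hle h.congruenceLattice_le).symm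

lemma image_wellRoundedCoords_inter (h : IsCoincidenceFrame L d e f)
    (hσ : coincidenceIndex L (ℝ ∙ e)ᗮ.reflection ≠ 0) (x : ℝ) :
    rhombicLattice e f '' (wellRoundedCoords d e f ∩ {z | (z.1 * z.2 : ℝ) ≤
      d / (2 * coincidenceIndex L (ℝ ∙ e)ᗮ.reflection) * x}) =
      ⋃ n ∈ Finset.Icc 1 ⌊x⌋₊, wellRoundedSublattices L n := by
  have hd : (0 : ℝ) < d := Nat.cast_pos.2 h.pos
  have hindex {z : ℤ × ℤ} (hz : z ∈ wellRoundedCoords d e f) :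
      latticeIndex L (rhombicLattice e f z) ∈ Finset.Icc 1 ⌊x⌋₊ ↔
        (z.1 * z.2 : ℝ) ≤ d / (2 * coincidenceIndex L (ℝ ∙ e)ᗮ.reflection) * x := by
    have hpos : (0 : ℝ) < z.1 * z.2 := mul_pos (Int.cast_pos.2 hz.1) (Int.cast_pos.2 hz.2.1)
    have hne : latticeIndex L (rhombicLattice e f z) ≠ 0 := by
      rw [← Nat.cast_ne_zero (R := ℝ), h.latticeIndex_rhombicLattice hz]
      positivity
    rw [Finset.mem_Icc, and_iff_right (Nat.one_le_iff_ne_zero.2 hne), Nat.le_floor_iff' hne,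
      h.latticeIndex_rhombicLattice hz, div_mul_eq_mul_div, div_mul_eq_mul_div, div_le_iff₀ hd,
      le_div_iff₀ (by positivity)]
    exact iff_of_eq (by ring_nf)
  ext M
  simp only [Set.mem_iUnion, exists_prop]
  constructor
  · rintro ⟨z, ⟨hz, hzx⟩, rfl⟩
    obtain ⟨hzL, hzM⟩ := h.image_wellRoundedCoords.le (Set.mem_image_of_mem _ hz)
    exact ⟨_, (hindex hz).2 hzx, hzL, rfl, hzM⟩
  · rintro ⟨n, hn, hML, rfl, hM⟩
    obtain ⟨z, hz, rfl⟩ := h.exists_eq_rhombicLattice hML hM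
    exact ⟨z, ⟨hz, (hindex hz).1 hn⟩, rfl⟩

lemma finite_wellRoundedSublattices (h : IsCoincidenceFrame L d e f)
    (hσ : coincidenceIndex L (ℝ ∙ e)ᗮ.reflection ≠ 0) {n : ℕ} (hn : 1 ≤ n) :
    (wellRoundedSublattices L n).Finite := by
  have he := norm_pos_iff.2 h.left_ne
  have hf := norm_pos_iff.2 h.right_ne
  have hunion : (rhombicLattice e f '' (wellRoundedCoords d e f ∩ {z | (z.1 * z.2 : ℝ) ≤
      d / (2 * coincidenceIndex L (ℝ ∙ e)ᗮ.reflection) * n})).Finite :=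
    (finite_sectorPoints_inter_mul_le h.pos (by positivity) _ _).image _
  rw [h.image_wellRoundedCoords_inter hσ] at hunion
  have hmem : n ∈ Finset.Icc 1 ⌊(n : ℝ)⌋₊ := Finset.mem_Icc.2 ⟨hn, (Nat.floor_natCast n).ge⟩
  exact hunion.subset (Set.subset_biUnion_of_mem (u := wellRoundedSublattices L) hmem)

lemma wellRoundedCount_eq (h : IsCoincidenceFrame L d e f)
    (hσ : coincidenceIndex L (ℝ ∙ e)ᗮ.reflection ≠ 0) (x : ℝ) :
    wellRoundedCount L x = (wellRoundedCoords d e f ∩ {z | (z.1 * z.2 : ℝ) ≤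
      d / (2 * coincidenceIndex L (ℝ ∙ e)ᗮ.reflection) * x}).ncard := by
  have hdisj : (Finset.Icc 1 ⌊x⌋₊ : Set ℕ).PairwiseDisjoint (wellRoundedSublattices L) :=
    fun n _ m _ hnm ↦ Set.disjoint_left.2 fun M hn hm ↦ hnm (hn.2.1.symm.trans hm.2.1)
  rw [wellRoundedCount, ← ncard_biUnion_finset
      (fun n hn ↦ h.finite_wellRoundedSublattices hσ (Finset.mem_Icc.1 hn).1) hdisj,
    ← h.image_wellRoundedCoords_inter hσ,
    (h.injOn_rhombicLattice.mono Set.inter_subset_left).ncard_image]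

lemma wellRoundedCount_isBigO (h : IsCoincidenceFrame L d e f)
    (hσ : coincidenceIndex L (ℝ ∙ e)ᗮ.reflection ≠ 0) :
    (fun x : ℝ ↦ (wellRoundedCount L x : ℝ) -
      Real.log 3 / (4 * (coincidenceIndex L (ℝ ∙ e)ᗮ.reflection : ℝ)) * x)
      =O[atTop] fun x ↦ √x := by
  have he := norm_pos_iff.2 h.left_ne
  have hf := norm_pos_iff.2 h.right_ne
  have hd : (0 : ℝ) < d := Nat.cast_pos.2 h.pos
  set c : ℝ := d / (2 * coincidenceIndex L (ℝ ∙ e)ᗮ.reflection) with hc_def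
  have hc : 0 < c := by positivity
  have hslope : √3 * ‖e‖ / ‖f‖ / (‖e‖ / (√3 * ‖f‖)) = 3 := by
    field_simp
    exact Real.sq_sqrt zero_le_three
  have hslope_le : ‖e‖ / (√3 * ‖f‖) ≤ √3 * ‖e‖ / ‖f‖ := by
    rw [← one_le_div (by positivity), hslope]
    norm_num
  have hcount := (ncard_sectorPoints_inter_isBigO h.pos (by positivity) hslope_le).comp_tendsto
    (tendsto_id.const_mul_atTop hc)
  have hsqrt : (fun x : ℝ ↦ √(c * x)) =O[atTop] fun x ↦ √x := by
    simpa only [Real.sqrt_mul hc.le] using isBigO_const_mul_self (√c) Real.sqrt atTop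
  refine (hcount.trans hsqrt).congr_left fun x ↦ ?_
  rw [h.wellRoundedCount_eq hσ, Function.comp_apply, hslope, id_eq]
  congr 1
  rw [hc_def]
  field_simp
  ring

end IsCoincidenceFrame

theorem theorem6_general {E : Type*} [NormedAddCommGroup E] [InnerProductSpace ℝ E]
    (hE : Module.finrank ℝ E = 2) (L : Submodule ℤ E) [DiscreteTopology L]
    (h2 : {R : E ≃ₗᵢ[ℝ] E | IsCoincidenceReflection L R}.encard = 2) :
    (∀ n : ℕ, 1 ≤ n → (wellRoundedSublattices L n).Finite) ∧
    ∃ σ : ℕ, 1 ≤ σ ∧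
      (∀ R : E ≃ₗᵢ[ℝ] E, IsCoincidenceReflection L R → coincidenceIndex L R = σ) ∧
      (fun x : ℝ ↦ (wellRoundedCount L x : ℝ) - Real.log 3 / (4 * (σ : ℝ)) * x)
        =O[atTop] (fun x : ℝ ↦ √x) := by
  obtain ⟨d, e, f, h⟩ := exists_isCoincidenceFrame hE L h2
  have hσ := h.coincidenceIndex_ne_zero
  exact ⟨fun _ ↦ h.finite_wellRoundedSublattices hσ, coincidenceIndex L (ℝ ∙ e)ᗮ.reflection,
    Nat.one_le_iff_ne_zero.2 hσ, fun _ ↦ h.coincidenceIndex_eq, h.wellRoundedCount_isBigO hσ⟩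

theorem theorem6 (L : Submodule ℤ (EuclideanSpace ℝ (Fin 2)))
    [DiscreteTopology L] [IsZLattice ℝ L]
    (h2 : {R : EuclideanSpace ℝ (Fin 2) ≃ₗᵢ[ℝ] EuclideanSpace ℝ (Fin 2) |
      IsCoincidenceReflection L R}.encard = 2) :
    (∀ n : ℕ, 1 ≤ n → (wellRoundedSublattices L n).Finite) ∧
    ∃ σ : ℕ, 1 ≤ σ ∧
      (∀ R : EuclideanSpace ℝ (Fin 2) ≃ₗᵢ[ℝ] EuclideanSpace ℝ (Fin 2),
        IsCoincidenceReflection L R → coincidenceIndex L R = σ) ∧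
      (fun x : ℝ => (wellRoundedCount L x : ℝ) - Real.log 3 / (4 * (σ : ℝ)) * x)
        =O[atTop] (fun x : ℝ => Real.sqrt x) :=
  theorem6_general finrank_euclideanSpace_fin L h2
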